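/- Let $1\le \ell\le d$ be integers, $[d]=\{1,\dots,d\}$, and let $v:2^{[d]}\to\mathbb R$ be any set function. Let $\mathcal S_\ell=\{T\subseteq[d]:|T|\le \ell\}$. The Faithful Shapley Interaction index (Faith-Shap) of $v$ with maximum interaction order $\ell$ is the vector $\mathcal E^{\text{F-Shap}}(v,\ell)=(\mathcal E^{\text{F-Shap}}_T(v,\ell))_{T\in\mathcal S_\ell}$ that solves $$\min_{\mathcal E\in\mathbb R^{\mathcal S_\ell}}\ \sum_{S\subseteq[d],\,1\le|S|\le d-1}\mu(S)\Big(v(S)-\sum_{T\subseteq S,\,|T|\le\ell}\mathcal E_T\Big)^2\quad\text{subject to}\quad v(S)=\sum_{T\subseteq S,\,|T|\le\ell}\mathcal E_T\ \text{ for } S\in\{\emptyset,[d]\},$$ where $\mu(S)=c\,\dfrac{d-1}{\binom{d}{|S|}\,|S|\,(d-|S|)}$ for $1\le|S|\le d-1$, with an arbitrary constant $c>0$ (equivalently, the weighted least squares problem with $\mu(\emptyset)=\mu([d])=\infty$). This problem has a solution, which is unique and does not depend on $c$. Let $g(x)=\sum_{T\subseteq[d]}v(T)\prod_{i\in T}x_i\prod_{i\notin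 T}(1-x_i)$ be the Owen multilinear extension of $v$. For $S=\{i_1,\dots,i_s\}\subseteq[d]$ write $\Delta_S g(x)=\dfrac{\partial^s g(x)}{\partial x_{i_1}\cdots\partial x_{i_s}}$. Let $x\mapsto I_x(\ell,\ell)$ be the cumulative distribution function of the Beta distribution with parameters $(\ell,\ell)$. Then for every $S\subseteq[d]$ with $|S|=\ell$ the function $x\mapsto\Delta_S g(x,\dots,x)$ is integrable on $[0,1]$ with respect to $dI_x(\ell,\ell)$, and $$\mathcal E^{\text{F-Shap}}_S(v,\ell)=\int_{0}^{1}\Delta_S g(x,\dots,x)\,dI_x(\ell,\ell).$$ -/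

import Mathlib

open scoped ENNReal
open MeasureTheory ProbabilityTheory

/-- The coalitions of `[d]` of size at most `ℓ`. -/
abbrev LowCoalition (d ℓ : ℕ) : Type := {T : Finset (Fin d) // T.card ≤ ℓ}

/-- `∑_{T ⊆ S, |T| ≤ ℓ} E_T`, the value that the interaction index `E` predicts for `S`. -/
noncomputable def predictedValue {d ℓ : ℕ} (E : LowCoalition d ℓ → ℝ) (S : Finset (Fin d)) : ℝ :=
  ∑ T : LowCoalition d ℓ with T.1 ⊆ S, E T

/-- Sum of the weighted squared errors over the coalitions of finite weight. -/
noncomputable def weightedError {d ℓ : ℕ} (μ : Finset (Fin d) → ℝ≥0∞) (v : Finset (Fin d) → ℝ)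
    (E : LowCoalition d ℓ → ℝ) : ℝ :=
  open scoped Classical in
  ∑ S : Finset (Fin d) with μ S < ⊤, (μ S).toReal * (v S - predictedValue E S) ^ 2

/-- The constraints: the prediction is exact on every coalition of infinite weight. -/
def IsFeasible {d ℓ : ℕ} (μ : Finset (Fin d) → ℝ≥0∞) (v : Finset (Fin d) → ℝ)
    (E : LowCoalition d ℓ → ℝ) : Prop :=
  ∀ S, μ S = ⊤ → v S = predictedValue E S

/-- A coalition weighting function is proper if it is positive everywhere and finite on every
coalition other than the empty and the full one. -/
def IsProperWeight {d : ℕ} (μ : Finset (Fin d) → ℝ≥0∞) : Prop :=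
  (∀ S, 0 < μ S) ∧ ∀ S : Finset (Fin d), 1 ≤ S.card → S.card ≤ d - 1 → μ S < ⊤

/-- `E` is the value at `(v, ℓ)` of a Faith-Interaction index with weighting function `μ`: the
weighting function is proper and `E` minimizes the constrained weighted regression problem. -/
def IsFaithInteraction {d ℓ : ℕ} (μ : Finset (Fin d) → ℝ≥0∞) (v : Finset (Fin d) → ℝ)
    (E : LowCoalition d ℓ → ℝ) : Prop :=
  IsProperWeight μ ∧ IsFeasible μ v E ∧
    ∀ E' : LowCoalition d ℓ → ℝ, IsFeasible μ v E' → weightedError μ v E ≤ weightedError μ v E'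

/-- The Faith-Shap coalition weights: infinite on the empty and the full coalition and, with one
positive constant `c`, equal to `c (d - 1) / (binom(d, |S|) |S| (d - |S|))` on the others. -/
def IsFaithShapWeight {d : ℕ} (μ : Finset (Fin d) → ℝ≥0∞) : Prop :=
  μ ∅ = ⊤ ∧ μ Finset.univ = ⊤ ∧
    ∃ c : ℝ, 0 < c ∧ ∀ S : Finset (Fin d), 1 ≤ S.card → S.card ≤ d - 1 →
      μ S = ENNReal.ofReal
        (c * (((d : ℝ) - 1) / ((d.choose S.card : ℝ) * (S.card : ℝ) * ((d : ℝ) - (S.card : ℝ)))))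

/-- `E` is the Faith-Shap index `(E_S(v, ℓ))_{|S| ≤ ℓ}` of the set function `v`. -/
def IsFaithShap {d : ℕ} (ℓ : ℕ) (v : Finset (Fin d) → ℝ) (E : LowCoalition d ℓ → ℝ) : Prop :=
  ∃ μ : Finset (Fin d) → ℝ≥0∞, IsFaithShapWeight μ ∧ IsFaithInteraction μ v E

/-- The Owen multilinear extension of a set function. -/
noncomputable def owenExtension {d : ℕ} (v : Finset (Fin d) → ℝ) (x : Fin d → ℝ) : ℝ :=
  ∑ T : Finset (Fin d), v T * (∏ i ∈ T, x i) * ∏ i ∈ Tᶜ, (1 - x i)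

/-- The partial derivative `∂f/∂x_i`. -/
noncomputable def partialDeriv {d : ℕ} (i : Fin d) (f : (Fin d → ℝ) → ℝ) (x : Fin d → ℝ) : ℝ :=
  deriv (fun t : ℝ => f (Function.update x i t)) (x i)

/-- The `S`-derivative `∂^s f / ∂x_{i_1} ⋯ ∂x_{i_s}`, where `S = {i_1 < ⋯ < i_s}`. -/
noncomputable def setDeriv {d : ℕ} (S : Finset (Fin d)) (f : (Fin d → ℝ) → ℝ) :
    (Fin d → ℝ) → ℝ :=
  (S.sort (· ≤ ·)).foldr partialDeriv f

/-- The cumulative distribution function `x ↦ I_x(ℓ, ℓ)` of the Beta distribution with both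
parameters equal to `ℓ`. -/
noncomputable def betaCDF (ℓ : ℕ) : StieltjesFunction ℝ :=
  cdf (betaMeasure (ℓ : ℝ) (ℓ : ℝ))

/-! The right-hand side is linear in `v`, so split `v` into the prediction of `E` and the residual
`r`. The prediction is a combination of unanimity games of coalitions of size at most `ℓ`, whose
multilinear extensions are monomials of degree at most `ℓ`. Since `|S| = ℓ`, its `S`-derivative is
the constant `E_S`, and integrating against a probability measure returns `E_S`. It remains to show
that the integral for `r` vanishes.

The `S`-derivative of the Owen term of `T`, restricted to the diagonal, is a sign times `x ^ |T \ S|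
* (1 - x) ^ |(S ∪ T)ᶜ|`, so its integral is a ratio of Beta functions. For `|S| = ℓ` the Gamma
arguments are `|T| + |S \ T|` and `d - |T| + |S ∩ T|`. Splitting off `(|T| - 1)! (d - |T| - 1)!`
leaves, up to a constant, the Faith-Shap weight of `T` times `risingKernel S T`
(`Gamma_mul_Gamma_eq_faithShapWeight`). Hence the integral for `r` is a multiple of the weighted
inner product of `r` with `risingKernel S`.

This kernel has interaction order at most `ℓ` (`risingKernel_mem_lowOrder`) and vanishes at `∅` and
at the full coalition. It is therefore an admissible direction, and the normal equations of the
constrained minimization say that `r` is orthogonal to it. -/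

/-! ### Set functions of low interaction order -/

/-- The linear map sending an interaction index to the set function that it predicts. -/
noncomputable def predictionMap (d ℓ : ℕ) :
    (LowCoalition d ℓ → ℝ) →ₗ[ℝ] (Finset (Fin d) → ℝ) where
  toFun := predictedValue
  map_add' E F := by
    ext S
    simp [predictedValue, Finset.sum_add_distrib]
  map_smul' a E := by
    ext S
    simp [predictedValue, Finset.mul_sum]

@[simp]
theorem predictionMap_apply {d ℓ : ℕ} (E : LowCoalition d ℓ → ℝ) (S : Finset (Fin d)) :
    predictionMap d ℓ E S = predictedValue E S := rfl

theorem predictedValue_eq_sum_ite {d ℓ : ℕ} (E : LowCoalition d ℓ → ℝ) (S : Finset (Fin d)) :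
    predictedValue E S = ∑ T : LowCoalition d ℓ, E T * (if T.1 ⊆ S then 1 else 0) := by
  simp [predictedValue, Finset.sum_filter]

/-- The system is triangular for inclusion: evaluating at `T`, every proper subset contributes zero
by induction on size, and only `E T` remains. -/
theorem predictionMap_injective (d ℓ : ℕ) : Function.Injective (predictionMap d ℓ) := by
  rw [injective_iff_map_eq_zero]
  intro E hE
  have key : ∀ n : ℕ, ∀ T : LowCoalition d ℓ, T.1.card = n → E T = 0 := by
    intro n
    induction n using Nat.strong_induction_on with
    | _ n ih =>
      intro T hT
      have h : predictedValue E T.1 = 0 := congrFun hE T.1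
      rw [predictedValue, Finset.sum_eq_single_of_mem T (by simp)] at h
      · exact h
      · intro U hU hne
        have hUT : U.1 ⊆ T.1 := by simpa using hU
        have hlt : U.1.card < T.1.card :=
          Finset.card_lt_card (hUT.ssubset_of_ne fun h => hne (Subtype.ext h))
        exact ih _ (hT ▸ hlt) U rfl
  ext T
  exact key _ T rfl

/-- The unanimity game of the coalition `U`. -/
def unanimity {d : ℕ} (U : Finset (Fin d)) : Finset (Fin d) → ℝ :=
  fun T => if U ⊆ T then 1 else 0

theorem unanimity_mul {d : ℕ} (U W : Finset (Fin d)) :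
    unanimity U * unanimity W = unanimity (U ∪ W) := by
  ext T
  by_cases h : U ⊆ T <;> by_cases h' : W ⊆ T <;> simp [unanimity, Finset.union_subset_iff, h, h']

/-- The set functions that are combinations of unanimity games of coalitions of size at most
`n`. -/
def lowOrder (d n : ℕ) : Submodule ℝ (Finset (Fin d) → ℝ) :=
  Submodule.span ℝ (unanimity '' {U | U.card ≤ n})

theorem unanimity_mem_lowOrder {d n : ℕ} {U : Finset (Fin d)} (hU : U.card ≤ n) :
    unanimity U ∈ lowOrder d n :=
  Submodule.subset_span ⟨U, hU, rfl⟩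

theorem mul_mem_lowOrder {d m n : ℕ} {f g : Finset (Fin d) → ℝ} (hf : f ∈ lowOrder d m)
    (hg : g ∈ lowOrder d n) : f * g ∈ lowOrder d (m + n) := by
  have h : lowOrder d m * lowOrder d n ≤ lowOrder d (m + n) := by
    rw [lowOrder, lowOrder, Submodule.span_mul_span, Submodule.span_le]
    rintro _ ⟨_, ⟨U, hU, rfl⟩, _, ⟨W, hW, rfl⟩, rfl⟩
    change unanimity U * unanimity W ∈ lowOrder d (m + n)
    rw [unanimity_mul]
    exact unanimity_mem_lowOrder ((Finset.card_union_le U W).trans (add_le_add hU hW))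
  exact h (Submodule.mul_mem_mul hf hg)

theorem one_mem_lowOrder (d n : ℕ) : (1 : Finset (Fin d) → ℝ) ∈ lowOrder d n := by
  convert unanimity_mem_lowOrder (U := (∅ : Finset (Fin d))) (n := n) (by simp)
  ext T
  simp [unanimity]

theorem card_inter_mem_lowOrder {d : ℕ} (A : Finset (Fin d)) :
    (fun T : Finset (Fin d) => ((T ∩ A).card : ℝ)) ∈ lowOrder d 1 := by
  have h : (fun T : Finset (Fin d) => ((T ∩ A).card : ℝ)) = ∑ i ∈ A, unanimity {i} := by
    ext T
    simp [unanimity, Finset.inter_comm T A]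
  rw [h]
  exact Submodule.sum_mem _ fun i _ => unanimity_mem_lowOrder (by simp)

theorem lowOrder_le_range_predictionMap (d n : ℕ) :
    lowOrder d n ≤ LinearMap.range (predictionMap d n) := by
  rw [lowOrder, Submodule.span_le]
  rintro _ ⟨U, hU, rfl⟩
  refine ⟨Pi.single ⟨U, hU⟩ 1, ?_⟩
  ext T
  rw [predictionMap_apply, predictedValue_eq_sum_ite,
    Finset.sum_eq_single_of_mem ⟨U, hU⟩ (Finset.mem_univ _)]
  · simp [unanimity]
  · intro W _ hW
    simp [hW]

/-! ### The representing set function -/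

/-- The set function `T ↦ (-1)^|A \ T| (|T|)_{|A \ T|} (d - |T|)_{|A ∩ T|}`, where `(x)_n` is the
rising factorial. -/
noncomputable def risingKernel {d : ℕ} (A T : Finset (Fin d)) : ℝ :=
  (-1) ^ (A \ T).card * (T.card.ascFactorial (A \ T).card : ℝ) *
    ((d - T.card).ascFactorial (A ∩ T).card : ℝ)

/-- A new element `i` lengthens one of the two rising factorials: the new factor is `d - |T| + |A ∩
T|` if `i ∈ T` and `-(|T| + |A \ T|)` otherwise. The indicator of `i ∈ T` merges both cases into one
factor of order 1, so each element raises the order by at most one. -/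
theorem risingKernel_insert {d : ℕ} {A : Finset (Fin d)} {i : Fin d} (hi : i ∉ A)
    (T : Finset (Fin d)) :
    risingKernel (insert i A) T =
      unanimity {i} T * ((d : ℝ) + A.card) * risingKernel A T -
        ((T.card : ℝ) + (A.card - (T ∩ A).card)) * risingKernel A T := by
  have hTd : T.card ≤ d := by simpa using Finset.card_le_univ T
  have hA : (A.card : ℝ) = (A \ T).card + (A ∩ T).card := by
    exact_mod_cast (Finset.card_sdiff_add_card_inter A T).symm
  rw [Finset.inter_comm T A, hA]
  by_cases hT : i ∈ T
  · have h1 : insert i A \ T = A \ T := Finset.insert_sdiff_of_mem A hT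
    have h2 : (insert i A ∩ T).card = (A ∩ T).card + 1 := by
      rw [Finset.insert_inter_of_mem hT, Finset.card_insert_of_notMem (by simp [hi])]
    simp only [risingKernel, h1, h2, Nat.ascFactorial_succ, unanimity,
      Finset.singleton_subset_iff, hT, if_true]
    push_cast [Nat.cast_sub hTd]
    ring
  · have h1 : insert i A ∩ T = A ∩ T := Finset.insert_inter_of_notMem hT
    have h2 : (insert i A \ T).card = (A \ T).card + 1 := by
      rw [Finset.insert_sdiff_of_notMem A hT, Finset.card_insert_of_notMem (by simp [hi])]
    simp only [risingKernel, h1, h2, Nat.ascFactorial_succ, unanimity,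
      Finset.singleton_subset_iff, hT, if_false]
    push_cast
    ring

theorem risingKernel_mem_lowOrder {d : ℕ} (A : Finset (Fin d)) :
    risingKernel A ∈ lowOrder d A.card := by
  induction A using Finset.induction_on with
  | empty =>
    have h : risingKernel (∅ : Finset (Fin d)) = 1 := by
      ext T
      simp [risingKernel]
    rw [h]
    exact one_mem_lowOrder d _
  | insert i A hi ih =>
    rw [Finset.card_insert_of_notMem hi, add_comm]
    have h : risingKernel (insert i A) =
        (((d : ℝ) + A.card) • unanimity {i} -
          ((fun T : Finset (Fin d) => ((T ∩ Finset.univ).card : ℝ)) + ((A.card : ℝ) • 1 -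
            fun T : Finset (Fin d) => ((T ∩ A).card : ℝ)))) * risingKernel A := by
      ext T
      rw [risingKernel_insert hi]
      simp
      ring
    rw [h]
    refine mul_mem_lowOrder (Submodule.sub_mem _ ?_ (Submodule.add_mem _ ?_
      (Submodule.sub_mem _ ?_ ?_))) ih
    · exact Submodule.smul_mem _ _ (unanimity_mem_lowOrder (by simp))
    · exact card_inter_mem_lowOrder _
    · exact Submodule.smul_mem _ _ (one_mem_lowOrder d 1)
    · exact card_inter_mem_lowOrder _

theorem risingKernel_empty {d : ℕ} {A : Finset (Fin d)} (hA : 1 ≤ A.card) :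
    risingKernel A ∅ = 0 := by
  obtain ⟨n, hn⟩ := Nat.exists_eq_add_of_le' hA
  simp [risingKernel, hn, Nat.zero_ascFactorial]

theorem risingKernel_univ {d : ℕ} {A : Finset (Fin d)} (hA : 1 ≤ A.card) :
    risingKernel A Finset.univ = 0 := by
  obtain ⟨n, hn⟩ := Nat.exists_eq_add_of_le' hA
  simp [risingKernel, hn, Nat.zero_ascFactorial]

/-! ### The constrained weighted regression problem -/

/-- The Faith-Shap weight of coalitions of size `s`, extended by `0` to `s = 0` and `s = d`. -/
noncomputable def faithShapWeight (d s : ℕ) : ℝ :=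
  ((d : ℝ) - 1) / ((d.choose s : ℝ) * (s : ℝ) * ((d : ℝ) - (s : ℝ)))

theorem faithShapWeight_pos {d s : ℕ} (hs : 1 ≤ s) (hsd : s ≤ d - 1) :
    0 < faithShapWeight d s := by
  have h1 : (0 : ℝ) < s := by exact_mod_cast hs
  have h2 : (s : ℝ) < d := by exact_mod_cast (by omega : s < d)
  have h3 : (1 : ℝ) < d := by exact_mod_cast (by omega : 1 < d)
  have h4 : (0 : ℝ) < d.choose s := by exact_mod_cast Nat.choose_pos (by omega)
  exact div_pos (by linarith) (mul_pos (mul_pos h4 h1) (by linarith))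

theorem card_mem_Icc_or {d : ℕ} (S : Finset (Fin d)) :
    S = ∅ ∨ S = Finset.univ ∨ (1 ≤ S.card ∧ S.card ≤ d - 1) := by
  rcases S.eq_empty_or_nonempty with h | h
  · exact Or.inl h
  by_cases h' : S = Finset.univ
  · exact Or.inr (Or.inl h')
  · have h1 := (Finset.card_lt_iff_ne_univ S).2 h'
    rw [Fintype.card_fin] at h1
    exact Or.inr (Or.inr ⟨h.card_pos, Nat.le_sub_one_of_lt h1⟩)

-- The denominator vanishes here, and division by zero gives `0`. Sums over all coalitions thus
-- ignore the two constrained ones.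
@[simp]
theorem faithShapWeight_zero (d : ℕ) : faithShapWeight d 0 = 0 := by simp [faithShapWeight]

@[simp]
theorem faithShapWeight_self (d : ℕ) : faithShapWeight d d = 0 := by simp [faithShapWeight]

theorem faithShapWeight_nonneg {d : ℕ} (S : Finset (Fin d)) : 0 ≤ faithShapWeight d S.card := by
  rcases card_mem_Icc_or S with rfl | rfl | ⟨h1, h2⟩
  · simp
  · simp
  · exact (faithShapWeight_pos h1 h2).le

/-- The inner product of set functions with the Faith-Shap weights. -/
noncomputable def faithShapForm (d : ℕ) :
    (Finset (Fin d) → ℝ) →ₗ[ℝ] (Finset (Fin d) → ℝ) →ₗ[ℝ] ℝ :=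
  LinearMap.mk₂ ℝ (fun f g => ∑ S, faithShapWeight d S.card * (f S * g S))
    (fun f f' g => by simp [add_mul, mul_add, Finset.sum_add_distrib])
    (fun a f g => by
      simp only [Pi.smul_apply, smul_eq_mul, Finset.mul_sum]
      exact Finset.sum_congr rfl fun S _ => by ring)
    (fun f g g' => by simp [mul_add, Finset.sum_add_distrib])
    (fun a f g => by
      simp only [Pi.smul_apply, smul_eq_mul, Finset.mul_sum]
      exact Finset.sum_congr rfl fun S _ => by ring)

theorem faithShapForm_apply {d : ℕ} (f g : Finset (Fin d) → ℝ) :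
    faithShapForm d f g = ∑ S, faithShapWeight d S.card * (f S * g S) := rfl

theorem faithShapForm_comm {d : ℕ} (f g : Finset (Fin d) → ℝ) :
    faithShapForm d f g = faithShapForm d g f := by
  simp only [faithShapForm_apply, mul_comm]

theorem faithShapForm_self_nonneg {d : ℕ} (f : Finset (Fin d) → ℝ) :
    0 ≤ faithShapForm d f f := by
  rw [faithShapForm_apply]
  exact Finset.sum_nonneg fun S _ => mul_nonneg (faithShapWeight_nonneg S) (mul_self_nonneg _)

theorem eq_zero_of_faithShapForm_self {d : ℕ} {f : Finset (Fin d) → ℝ} (h0 : f ∅ = 0)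
    (h1 : f Finset.univ = 0) (h : faithShapForm d f f = 0) : f = 0 := by
  ext S
  rcases card_mem_Icc_or S with rfl | rfl | ⟨hS, hS'⟩
  · exact h0
  · exact h1
  · rw [faithShapForm_apply, Finset.sum_eq_zero_iff_of_nonneg fun S _ =>
      mul_nonneg (faithShapWeight_nonneg S) (mul_self_nonneg _)] at h
    have := h S (Finset.mem_univ S)
    simpa [(faithShapWeight_pos hS hS').ne'] using this

theorem IsFaithShapWeight.ne_top {d : ℕ} {μ : Finset (Fin d) → ℝ≥0∞} (hμ : IsFaithShapWeight μ)
    {S : Finset (Fin d)} (h1 : 1 ≤ S.card) (h2 : S.card ≤ d - 1) : μ S ≠ ⊤ := by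
  obtain ⟨-, -, c, -, h⟩ := hμ
  rw [h S h1 h2]
  exact ENNReal.ofReal_ne_top

theorem IsFaithShapWeight.isProperWeight {d : ℕ} {μ : Finset (Fin d) → ℝ≥0∞}
    (hμ : IsFaithShapWeight μ) : IsProperWeight μ := by
  refine ⟨fun S => ?_, fun S h1 h2 => (hμ.ne_top h1 h2).lt_top⟩
  obtain ⟨h0, hu, c, hc, h⟩ := hμ
  rcases card_mem_Icc_or S with rfl | rfl | ⟨h1, h2⟩
  · simp [h0]
  · simp [hu]
  · rw [h S h1 h2, ENNReal.ofReal_pos]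
    exact mul_pos hc (faithShapWeight_pos h1 h2)

theorem IsFaithShapWeight.isFeasible_iff {d ℓ : ℕ} {μ : Finset (Fin d) → ℝ≥0∞}
    (hμ : IsFaithShapWeight μ) {v : Finset (Fin d) → ℝ} {E : LowCoalition d ℓ → ℝ} :
    IsFeasible μ v E ↔ v ∅ = predictedValue E ∅ ∧
      v Finset.univ = predictedValue E Finset.univ := by
  refine ⟨fun h => ⟨h _ hμ.1, h _ hμ.2.1⟩, fun h S hS => ?_⟩
  rcases card_mem_Icc_or S with rfl | rfl | ⟨h1, h2⟩
  · exact h.1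
  · exact h.2
  · exact absurd hS (hμ.ne_top h1 h2)

/-- The constant `c` only scales the objective, which is why the minimizer does not depend on it. -/
theorem IsFaithShapWeight.exists_weightedError_eq {d : ℕ} {μ : Finset (Fin d) → ℝ≥0∞}
    (hμ : IsFaithShapWeight μ) (ℓ : ℕ) (v : Finset (Fin d) → ℝ) :
    ∃ c : ℝ, 0 < c ∧ ∀ E : LowCoalition d ℓ → ℝ, weightedError μ v E =
      c * faithShapForm d (v - predictionMap d ℓ E) (v - predictionMap d ℓ E) := by
  obtain ⟨c, hc, h⟩ := hμ.2.2
  refine ⟨c, hc, fun E => ?_⟩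
  rw [weightedError, Finset.sum_filter, faithShapForm_apply, Finset.mul_sum]
  refine Finset.sum_congr rfl fun S _ => ?_
  rcases card_mem_Icc_or S with rfl | rfl | ⟨h1, h2⟩
  · simp [hμ.1]
  · simp [hμ.2.1]
  · rw [if_pos (hμ.ne_top h1 h2).lt_top, h S h1 h2]
    have hw := faithShapWeight_pos h1 h2
    rw [faithShapWeight] at hw
    rw [ENNReal.toReal_ofReal (mul_pos hc hw).le]
    simp only [faithShapWeight, Pi.sub_apply, predictionMap_apply]
    ring

/-- The normal equations of the constrained regression problem. -/
def SatisfiesNormalEquations {d ℓ : ℕ} (v : Finset (Fin d) → ℝ) (E : LowCoalition d ℓ → ℝ) : Prop :=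
  v ∅ = predictedValue E ∅ ∧ v Finset.univ = predictedValue E Finset.univ ∧
    ∀ F : LowCoalition d ℓ → ℝ, predictedValue F ∅ = 0 → predictedValue F Finset.univ = 0 →
      faithShapForm d (v - predictionMap d ℓ E) (predictionMap d ℓ F) = 0

theorem faithShapForm_sub_smul {d : ℕ} (r f : Finset (Fin d) → ℝ) (t : ℝ) :
    faithShapForm d (r - t • f) (r - t • f) =
      faithShapForm d r r - 2 * t * faithShapForm d r f + t ^ 2 * faithShapForm d f f := by
  simp only [map_sub, map_smul, LinearMap.sub_apply, LinearMap.smul_apply, smul_eq_mul,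
    faithShapForm_comm f r]
  ring

theorem IsFaithShap.satisfiesNormalEquations {d ℓ : ℕ} {v : Finset (Fin d) → ℝ} {E : LowCoalition d ℓ → ℝ}
    (h : IsFaithShap ℓ v E) : SatisfiesNormalEquations v E := by
  obtain ⟨μ, hμ, -, hf, hmin⟩ := h
  obtain ⟨c, hc, herr⟩ := hμ.exists_weightedError_eq ℓ v
  have hf' := hμ.isFeasible_iff.1 hf
  refine ⟨hf'.1, hf'.2, fun F hF0 hF1 => ?_⟩
  set r := v - predictionMap d ℓ E with hr
  have key : ∀ t : ℝ, 0 ≤ -(2 * t * faithShapForm d r (predictionMap d ℓ F)) +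
      t ^ 2 * faithShapForm d (predictionMap d ℓ F) (predictionMap d ℓ F) := by
    intro t
    have hfe : IsFeasible μ v (E + t • F) := by
      rw [hμ.isFeasible_iff]
      simp only [← predictionMap_apply, map_add, map_smul, Pi.add_apply, Pi.smul_apply]
      simp [hF0, hF1, hf'.1, hf'.2]
    have h1 := hmin _ hfe
    have h2 : v - predictionMap d ℓ (E + t • F) = r - t • predictionMap d ℓ F := by
      rw [map_add, map_smul, hr, sub_sub]
    rw [herr, herr, h2, faithShapForm_sub_smul, ← hr] at h1
    have := le_of_mul_le_mul_left h1 hc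
    linarith
  set a := faithShapForm d (predictionMap d ℓ F) (predictionMap d ℓ F)
  set b := faithShapForm d r (predictionMap d ℓ F)
  have ha : 0 ≤ a := faithShapForm_self_nonneg _
  -- The quadratic in `t` would be minimized at `b / a`, but `a` may be zero. The shifted
  -- denominator still makes the value negative unless `b = 0`.
  have h1 := key (b / (a + 1))
  have h2 : -(2 * (b / (a + 1)) * b) + (b / (a + 1)) ^ 2 * a =
      -(b ^ 2 * ((a + 2) / (a + 1) ^ 2)) := by
    field_simp
    ring
  rw [h2] at h1
  have h3 : 0 < (a + 2) / (a + 1) ^ 2 := by positivity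
  have h4 : b ^ 2 ≤ 0 := by
    by_contra! hb
    have := mul_pos hb h3
    linarith
  exact pow_eq_zero_iff two_ne_zero |>.1 (le_antisymm h4 (sq_nonneg b))

theorem exists_isFaithShapWeight (d : ℕ) :
    ∃ μ : Finset (Fin d) → ℝ≥0∞, IsFaithShapWeight μ := by
  classical
  refine ⟨fun S => if S = ∅ ∨ S = Finset.univ then ⊤ else
    ENNReal.ofReal (1 * faithShapWeight d S.card), by simp, by simp, 1, one_pos, ?_⟩
  intro S h1 h2
  have hS0 : S ≠ ∅ := by
    rintro rfl
    simp at h1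
  have hS1 : S ≠ Finset.univ := by
    rintro rfl
    simp at h1 h2
    omega
  simp [hS0, hS1, faithShapWeight]

theorem SatisfiesNormalEquations.isFaithShap {d ℓ : ℕ} {v : Finset (Fin d) → ℝ} {E : LowCoalition d ℓ → ℝ}
    (h : SatisfiesNormalEquations v E) : IsFaithShap ℓ v E := by
  obtain ⟨μ, hμ⟩ := exists_isFaithShapWeight d
  obtain ⟨h0, h1, hs⟩ := h
  refine ⟨μ, hμ, hμ.isProperWeight, hμ.isFeasible_iff.2 ⟨h0, h1⟩, fun E' hE' => ?_⟩
  obtain ⟨c, hc, herr⟩ := hμ.exists_weightedError_eq ℓ v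
  have hE'' := hμ.isFeasible_iff.1 hE'
  rw [herr, herr]
  refine mul_le_mul_of_nonneg_left ?_ hc.le
  have h2 : v - predictionMap d ℓ E' =
      (v - predictionMap d ℓ E) - (1 : ℝ) • predictionMap d ℓ (E' - E) := by
    rw [map_sub, one_smul]
    abel
  rw [h2, faithShapForm_sub_smul, hs (E' - E)]
  · have := faithShapForm_self_nonneg (predictionMap d ℓ (E' - E))
    linarith
  · simp only [← predictionMap_apply, map_sub, Pi.sub_apply] at *
    linarith [hE''.1]
  · simp only [← predictionMap_apply, map_sub, Pi.sub_apply] at *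
    linarith [hE''.2]

theorem SatisfiesNormalEquations.unique {d ℓ : ℕ} {v : Finset (Fin d) → ℝ} {E E' : LowCoalition d ℓ → ℝ}
    (h : SatisfiesNormalEquations v E) (h' : SatisfiesNormalEquations v E') : E' = E := by
  obtain ⟨h0, h1, hs⟩ := h
  obtain ⟨h0', h1', hs'⟩ := h'
  have e0 : predictedValue (E' - E) ∅ = 0 := by
    simp only [← predictionMap_apply, map_sub, Pi.sub_apply] at *
    linarith
  have e1 : predictedValue (E' - E) Finset.univ = 0 := by
    simp only [← predictionMap_apply, map_sub, Pi.sub_apply] at *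
    linarith
  have h2 : predictionMap d ℓ (E' - E) = 0 := by
    refine eq_zero_of_faithShapForm_self e0 e1 ?_
    have : predictionMap d ℓ (E' - E) =
        (v - predictionMap d ℓ E) - (v - predictionMap d ℓ E') := by
      rw [map_sub]
      abel
    nth_rewrite 1 [this]
    rw [map_sub, LinearMap.sub_apply, hs _ e0 e1, hs' _ e0 e1, sub_zero]
  exact sub_eq_zero.1 (predictionMap_injective d ℓ (by rw [h2, map_zero]))

theorem exists_predictedValue_eq {d ℓ : ℕ} (hℓ : 1 ≤ ℓ) (hd : 1 ≤ d) (v : Finset (Fin d) → ℝ) :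
    ∃ E : LowCoalition d ℓ → ℝ, v ∅ = predictedValue E ∅ ∧
      v Finset.univ = predictedValue E Finset.univ := by
  -- The two constraints are met by an order-1 function: a constant plus a multiple of the indicator
  -- of one player.
  have hmem : v ∅ • (1 : Finset (Fin d) → ℝ) +
      (v Finset.univ - v ∅) • unanimity {(⟨0, hd⟩ : Fin d)} ∈ lowOrder d ℓ :=
    Submodule.add_mem _ (Submodule.smul_mem _ _ (one_mem_lowOrder d ℓ))
      (Submodule.smul_mem _ _ (unanimity_mem_lowOrder (by simpa)))
  obtain ⟨E, hE⟩ := lowOrder_le_range_predictionMap d ℓ hmem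
  refine ⟨E, ?_, ?_⟩
  · rw [← predictionMap_apply, hE]
    simp [unanimity]
  · rw [← predictionMap_apply, hE]
    simp [unanimity]

/-- Starting from any feasible point, the correction is sought in the space `W` of directions
preserving the constraints. The form is definite on `W`, so the induced map to the dual is
injective, hence surjective by dimension. -/
theorem exists_satisfiesNormalEquations {d ℓ : ℕ} (hℓ : 1 ≤ ℓ) (hd : 1 ≤ d) (v : Finset (Fin d) → ℝ) :
    ∃ E : LowCoalition d ℓ → ℝ, SatisfiesNormalEquations v E := by
  obtain ⟨E₀, h0, h1⟩ := exists_predictedValue_eq hℓ hd v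
  let W : Submodule ℝ (LowCoalition d ℓ → ℝ) :=
    LinearMap.ker (LinearMap.proj ∅ ∘ₗ predictionMap d ℓ) ⊓
      LinearMap.ker (LinearMap.proj Finset.univ ∘ₗ predictionMap d ℓ)
  have hW : ∀ F, F ∈ W ↔ predictedValue F ∅ = 0 ∧ predictedValue F Finset.univ = 0 := by
    intro F
    simp [W]
  let B : W →ₗ[ℝ] Module.Dual ℝ W :=
    (faithShapForm d).compl₁₂ (predictionMap d ℓ ∘ₗ W.subtype) (predictionMap d ℓ ∘ₗ W.subtype)
  have hinj : Function.Injective B := by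
    rw [injective_iff_map_eq_zero]
    intro F hF
    have h2 : faithShapForm d (predictionMap d ℓ F) (predictionMap d ℓ F) = 0 :=
      LinearMap.congr_fun hF F
    have h3 : predictionMap d ℓ F = 0 := eq_zero_of_faithShapForm_self ((hW F).1 F.2).1 ((hW F).1 F.2).2 h2
    exact Subtype.ext (predictionMap_injective d ℓ (h3.trans (map_zero _).symm))
  have hsurj : Function.Surjective B :=
    (LinearMap.injective_iff_surjective_of_finrank_eq_finrank
      Subspace.dual_finrank_eq.symm).1 hinj
  obtain ⟨G, hG⟩ := hsurj ((faithShapForm d (v - predictionMap d ℓ E₀)) ∘ₗ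
    (predictionMap d ℓ ∘ₗ W.subtype))
  have hGW := (hW G).1 G.2
  refine ⟨E₀ + G, ?_, ?_, fun F hF0 hF1 => ?_⟩
  · simp only [← predictionMap_apply, map_add, Pi.add_apply] at *
    rw [hGW.1, add_zero, h0]
  · simp only [← predictionMap_apply, map_add, Pi.add_apply] at *
    rw [hGW.2, add_zero, h1]
  · have h2 : faithShapForm d (predictionMap d ℓ G) (predictionMap d ℓ F) =
        faithShapForm d (v - predictionMap d ℓ E₀) (predictionMap d ℓ F) :=
      LinearMap.congr_fun hG ⟨F, (hW F).2 ⟨hF0, hF1⟩⟩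
    rw [map_add, ← sub_sub, map_sub, LinearMap.sub_apply, h2, sub_self]

theorem existsUnique_isFaithShap {d ℓ : ℕ} (hℓ : 1 ≤ ℓ) (hd : 1 ≤ d) (v : Finset (Fin d) → ℝ) :
    ∃! E : LowCoalition d ℓ → ℝ, IsFaithShap ℓ v E := by
  obtain ⟨E, hE⟩ := exists_satisfiesNormalEquations hℓ hd v
  exact ⟨E, hE.isFaithShap, fun E' hE' => hE.unique hE'.satisfiesNormalEquations⟩

/-! ### Derivatives of the Owen extension -/

/-- The `A`-derivative of the monomial `∏_{i ∈ T} x_i ∏_{i ∉ T} (1 - x_i)`. -/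
def owenTerm {d : ℕ} (A T : Finset (Fin d)) (x : Fin d → ℝ) : ℝ :=
  ∏ j, if j ∈ A then (if j ∈ T then 1 else -1) else (if j ∈ T then x j else 1 - x j)

theorem owenExtension_eq_sum_owenTerm {d : ℕ} (v : Finset (Fin d) → ℝ) :
    owenExtension v = fun x => ∑ T, v T * owenTerm ∅ T x := by
  ext x
  refine Finset.sum_congr rfl fun T _ => ?_
  rw [mul_assoc, owenTerm, ← Finset.prod_mul_prod_compl T]
  congr 2
  · exact Finset.prod_congr rfl fun j hj => by simp [hj]
  · exact Finset.prod_congr rfl fun j hj => by simp [Finset.mem_compl.1 hj]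

/-- The term is affine in `x i`, so the derivative is the same at every `s`. -/
theorem hasDerivAt_owenTerm_update {d : ℕ} {A : Finset (Fin d)} {i : Fin d} (hi : i ∉ A)
    (T : Finset (Fin d)) (x : Fin d → ℝ) (s : ℝ) :
    HasDerivAt (fun t => owenTerm A T (Function.update x i t)) (owenTerm (insert i A) T x) s := by
  have h1 : ∀ t, owenTerm A T (Function.update x i t) = (if i ∈ T then t else 1 - t) *
      ∏ j ∈ Finset.univ.erase i,
        if j ∈ A then (if j ∈ T then 1 else -1) else (if j ∈ T then x j else 1 - x j) := by
    intro t
    rw [owenTerm, ← Finset.mul_prod_erase _ _ (Finset.mem_univ i)]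
    congr 1
    · simp [hi]
    · refine Finset.prod_congr rfl fun j hj => ?_
      simp [Finset.ne_of_mem_erase hj]
  have h2 : owenTerm (insert i A) T x = (if i ∈ T then 1 else -1) *
      ∏ j ∈ Finset.univ.erase i,
        if j ∈ A then (if j ∈ T then 1 else -1) else (if j ∈ T then x j else 1 - x j) := by
    rw [owenTerm, ← Finset.mul_prod_erase _ _ (Finset.mem_univ i)]
    congr 1
    · simp
    · refine Finset.prod_congr rfl fun j hj => ?_
      simp [Finset.ne_of_mem_erase hj]
  simp only [h1, h2]
  refine HasDerivAt.mul_const ?_ _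
  split_ifs
  · exact hasDerivAt_id' s
  · exact (hasDerivAt_id' s).const_sub 1

theorem foldr_partialDeriv_owenExtension {d : ℕ} (v : Finset (Fin d) → ℝ) (L : List (Fin d))
    (hL : L.Nodup) : L.foldr partialDeriv (owenExtension v) =
      fun x => ∑ T, v T * owenTerm L.toFinset T x := by
  induction L with
  | nil => simpa using owenExtension_eq_sum_owenTerm v
  | cons i L ih =>
    rw [List.nodup_cons] at hL
    ext x
    rw [List.foldr_cons, ih hL.2, partialDeriv, List.toFinset_cons]
    exact (HasDerivAt.fun_sum fun T _ => (hasDerivAt_owenTerm_update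
      (by simpa using hL.1) T x _).const_mul (v T)).deriv

theorem setDeriv_owenExtension {d : ℕ} (v : Finset (Fin d) → ℝ) (S : Finset (Fin d)) :
    setDeriv S (owenExtension v) = fun x => ∑ T, v T * owenTerm S T x := by
  rw [setDeriv, foldr_partialDeriv_owenExtension v _ (Finset.sort_nodup S _),
    Finset.sort_toFinset]

theorem owenTerm_diagonal {d : ℕ} (S T : Finset (Fin d)) (x : ℝ) :
    owenTerm S T (fun _ => x) =
      (-1) ^ (S \ T).card * (x ^ (T \ S).card * (1 - x) ^ (S ∪ T)ᶜ.card) := by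
  rw [owenTerm, Finset.prod_ite, Finset.prod_ite, Finset.prod_ite]
  simp only [Finset.prod_const, Finset.filter_filter, one_pow, one_mul]
  congr 2
  · congr 1
    ext j
    simp
  · congr 2
    ext j
    simp [and_comm]
  · congr 2
    ext j
    simp

theorem sum_unanimity_mul_owenTerm {d : ℕ} {S U : Finset (Fin d)} (h : U.card ≤ S.card)
    (x : Fin d → ℝ) : ∑ T, unanimity U T * owenTerm S T x = if U = S then 1 else 0 := by
  have h1 : ∀ T, unanimity U T * owenTerm S T x =
      (∏ j ∈ T, if j ∈ S then 1 else x j) *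
        ∏ j ∈ Tᶜ, if j ∈ U then 0 else if j ∈ S then -1 else 1 - x j := by
    intro T
    by_cases hUT : U ⊆ T
    · rw [unanimity, if_pos hUT, one_mul, owenTerm, ← Finset.prod_mul_prod_compl T]
      congr 1
      · exact Finset.prod_congr rfl fun j hj => by simp [hj]
      · refine Finset.prod_congr rfl fun j hj => ?_
        have hj' := Finset.mem_compl.1 hj
        have hjU : j ∉ U := fun hU => hj' (hUT hU)
        simp [hj', hjU]
    · obtain ⟨j, hjU, hjT⟩ := Finset.not_subset.1 hUT
      rw [unanimity, if_neg hUT, zero_mul,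
        Finset.prod_eq_zero (Finset.mem_compl.2 hjT) (by simp [hjU]), mul_zero]
  simp only [h1]
  -- The sum over all `T` factors coordinatewise. A coordinate in `S \ U` contributes `1 + (-1) =
  -- 0`, and the size bound provides one unless `U = S`.
  rw [← Fintype.prod_add]
  split_ifs with hUS
  · subst hUS
    refine Finset.prod_eq_one fun j _ => ?_
    by_cases hj : j ∈ U <;> simp [hj]
  · have hSU : ¬ S ⊆ U := fun hSU => hUS (Finset.eq_of_subset_of_card_le hSU h).symm
    obtain ⟨j, hjS, hjU⟩ := Finset.not_subset.1 hSU
    exact Finset.prod_eq_zero (Finset.mem_univ j) (by simp [hjS, hjU])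

theorem sum_predictedValue_mul_owenTerm {d ℓ : ℕ} (E : LowCoalition d ℓ → ℝ)
    {S : Finset (Fin d)} (hS : S.card = ℓ) (x : Fin d → ℝ) :
    ∑ T, predictedValue E T * owenTerm S T x = E ⟨S, hS.le⟩ := by
  simp only [predictedValue_eq_sum_ite, Finset.sum_mul]
  rw [Finset.sum_comm]
  have h : ∀ U : LowCoalition d ℓ, ∑ T, E U * (if U.1 ⊆ T then 1 else 0) * owenTerm S T x =
      E U * if U = ⟨S, hS.le⟩ then 1 else 0 := by
    intro U
    have := sum_unanimity_mul_owenTerm (hS ▸ U.2 : U.1.card ≤ S.card) x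
    simp only [mul_assoc, ← Finset.mul_sum]
    simp only [Subtype.ext_iff]
    exact congrArg _ this
  rw [Finset.sum_congr rfl fun U _ => h U]
  simp

/-! ### Moments of the Beta distribution -/

theorem integral_betaPDFReal {α β : ℝ} (hα : 0 < α) (hβ : 0 < β) :
    ∫ x, betaPDFReal α β x = 1 := by
  rw [integral_eq_lintegral_of_nonneg_ae]
  · have := lintegral_betaPDF_eq_one hα hβ
    simp only [betaPDF] at this
    simp [this]
  · refine Filter.Eventually.of_forall fun x => ?_
    by_cases h : 0 < x ∧ x < 1
    · exact (betaPDFReal_pos h.1 h.2 hα hβ).le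
    · simp [betaPDFReal, h]
  · exact (stronglyMeasurable_betaPDFReal α β).aestronglyMeasurable

/-- Multiplying by such a monomial only shifts the Beta parameters, so the moments follow from
normalization of the shifted density. -/
theorem betaPDFReal_mul_pow {α β : ℝ} (hα : 0 < α) (hβ : 0 < β) (a b : ℕ) (x : ℝ) :
    betaPDFReal α β x * (x ^ a * (1 - x) ^ b) =
      beta (α + a) (β + b) / beta α β * betaPDFReal (α + a) (β + b) x := by
  by_cases h : 0 < x ∧ x < 1
  · have h1 : 0 < 1 - x := by linarith [h.2]
    have h2 := (beta_pos hα hβ).ne'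
    have h3 := (beta_pos (by positivity : 0 < α + a) (by positivity : 0 < β + b)).ne'
    rw [betaPDFReal, betaPDFReal, if_pos h, if_pos h, add_sub_right_comm, add_sub_right_comm,
      Real.rpow_add_natCast h.1.ne', Real.rpow_add_natCast h1.ne']
    field_simp
  · simp [betaPDFReal, h]

theorem setIntegral_pow_betaMeasure {α β : ℝ} (hα : 0 < α) (hβ : 0 < β) (a b : ℕ) :
    ∫ x in Set.Icc (0 : ℝ) 1, x ^ a * (1 - x) ^ b ∂(betaMeasure α β) =
      beta (α + a) (β + b) / beta α β := by
  have h0 : ∀ x, (betaPDF α β x).toReal = betaPDFReal α β x := by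
    intro x
    refine ENNReal.toReal_ofReal ?_
    by_cases h : 0 < x ∧ x < 1
    · exact (betaPDFReal_pos h.1 h.2 hα hβ).le
    · simp [betaPDFReal, h]
  have hm : Measurable (betaPDF α β) := (measurable_betaPDFReal α β).ennreal_ofReal
  rw [betaMeasure, setIntegral_withDensity_eq_setIntegral_toReal_smul hm
    (Filter.Eventually.of_forall fun x => ENNReal.ofReal_lt_top) _ measurableSet_Icc]
  simp only [h0, smul_eq_mul, betaPDFReal_mul_pow hα hβ]
  rw [integral_const_mul, setIntegral_eq_integral_of_forall_compl_eq_zero,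
    integral_betaPDFReal (by positivity) (by positivity), mul_one]
  intro x hx
  exact if_neg fun h => hx ⟨h.1.le, h.2.le⟩

theorem betaCDF_measure {ℓ : ℕ} (hℓ : 1 ≤ ℓ) : (betaCDF ℓ).measure = betaMeasure ℓ ℓ := by
  have h : (0 : ℝ) < ℓ := by exact_mod_cast hℓ
  have := isProbabilityMeasureBeta h h
  exact measure_cdf _

theorem isProbabilityMeasure_betaCDF {ℓ : ℕ} (hℓ : 1 ≤ ℓ) :
    IsProbabilityMeasure (betaCDF ℓ).measure := by
  have h : (0 : ℝ) < ℓ := by exact_mod_cast hℓ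
  rw [betaCDF_measure hℓ]
  exact isProbabilityMeasureBeta h h

theorem betaCDF_measureReal_Icc {ℓ : ℕ} (hℓ : 1 ≤ ℓ) :
    (betaCDF ℓ).measure.real (Set.Icc 0 1) = 1 := by
  have h : (0 : ℝ) < ℓ := by exact_mod_cast hℓ
  have h1 := setIntegral_pow_betaMeasure h h 0 0
  rw [← betaCDF_measure hℓ] at h1
  simpa [(beta_pos h h).ne'] using h1

theorem continuous_owenTerm_diagonal {d : ℕ} (S T : Finset (Fin d)) :
    Continuous fun x : ℝ => owenTerm S T (fun _ => x) := by
  simp only [owenTerm_diagonal]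
  fun_prop

theorem integrableOn_betaCDF {ℓ : ℕ} (hℓ : 1 ≤ ℓ) {f : ℝ → ℝ} (hf : Continuous f) :
    IntegrableOn f (Set.Icc 0 1) (betaCDF ℓ).measure := by
  have := isProbabilityMeasure_betaCDF hℓ
  exact hf.continuousOn.integrableOn_compact isCompact_Icc

/-! ### The integral as a weighted inner product -/

theorem faithShapWeight_add_two (a b : ℕ) : faithShapWeight (a + b + 2) (a + 1) =
    ((a : ℝ) + b + 1) * a.factorial * b.factorial / (a + b + 2).factorial := by
  have h := Nat.add_choose_mul_factorial_mul_factorial (a + 1) (b + 1)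
  rw [show a + 1 + (b + 1) = a + b + 2 by ring,
    ← Nat.choose_symm_of_eq_add (show a + b + 2 = a + 1 + (b + 1) by ring), Nat.factorial_succ a, Nat.factorial_succ b] at h
  have h' : ((a + b + 2).choose (a + 1) : ℝ) * ((a + 1) * a.factorial) * ((b + 1) * b.factorial) =
      (a + b + 2).factorial := by exact_mod_cast h
  have hc : ((a + b + 2).choose (a + 1) : ℝ) ≠ 0 := by
    exact_mod_cast (Nat.choose_pos (by omega)).ne'
  rw [← h', faithShapWeight]
  have h1 : (a.factorial : ℝ) ≠ 0 := by positivity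
  have h2 : (b.factorial : ℝ) ≠ 0 := by positivity
  have h3 : ((a + b + 2 : ℕ) : ℝ) - ((a + 1 : ℕ) : ℝ) = b + 1 := by
    push_cast
    ring
  rw [h3]
  push_cast
  field_simp
  ring

theorem Gamma_mul_Gamma_eq_faithShapWeight {d : ℕ} (S T : Finset (Fin d))
    (h1 : 1 ≤ T.card) (h2 : T.card ≤ d - 1) :
    (-1) ^ (S \ T).card * (Real.Gamma (S.card + (T \ S).card) *
      Real.Gamma (S.card + (S ∪ T)ᶜ.card)) =
        d.factorial / (d - 1) * (faithShapWeight d T.card * risingKernel S T) := by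
  obtain ⟨a, ha⟩ := Nat.exists_eq_add_of_le' h1
  obtain ⟨b, hb⟩ : ∃ b, d = a + b + 2 := ⟨d - a - 2, by omega⟩
  have e1 := Finset.card_sdiff_add_card_inter S T
  have e2 := Finset.card_sdiff_add_card_inter T S
  rw [Finset.inter_comm T S] at e2
  have e3 := Finset.card_union_add_card_inter S T
  have e4 := Finset.card_add_card_compl (S ∪ T)
  rw [Fintype.card_fin] at e4
  -- Both sides equal `|S ∪ T|`, with `|T| = a + 1`. This uses that the Beta parameter is exactly
  -- `|S|`.
  have g1 : (S.card : ℝ) + (T \ S).card = (a + (S \ T).card : ℕ) + 1 := by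
    exact_mod_cast (by omega : S.card + (T \ S).card = a + (S \ T).card + 1)
  have g2 : (S.card : ℝ) + (S ∪ T)ᶜ.card = (b + (S ∩ T).card : ℕ) + 1 := by
    exact_mod_cast (by omega : S.card + (S ∪ T)ᶜ.card = b + (S ∩ T).card + 1)
  rw [g1, g2, Real.Gamma_nat_eq_factorial, Real.Gamma_nat_eq_factorial,
    ← Nat.factorial_mul_ascFactorial, ← Nat.factorial_mul_ascFactorial, risingKernel, ha,
    show d - (a + 1) = b + 1 by omega]
  have hw : faithShapWeight d (a + 1) =
      ((d : ℝ) - 1) * a.factorial * b.factorial / d.factorial := by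
    rw [hb, faithShapWeight_add_two]
    push_cast
    ring
  have hd : (d : ℝ) - 1 ≠ 0 := by
    rw [hb]
    push_cast
    have : (0 : ℝ) < a + b + 1 := by positivity
    intro h
    linarith
  have hf : (d.factorial : ℝ) ≠ 0 := by positivity
  rw [hw]
  push_cast
  field_simp

theorem setIntegral_owenTerm {d : ℕ} (S T : Finset (Fin d)) (hS : 1 ≤ S.card)
    (h1 : 1 ≤ T.card) (h2 : T.card ≤ d - 1) :
    ∫ x in Set.Icc (0 : ℝ) 1, owenTerm S T (fun _ => x) ∂(betaCDF S.card).measure =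
      d.factorial / (d - 1) / (Real.Gamma (S.card + d) * beta S.card S.card) *
        (faithShapWeight d T.card * risingKernel S T) := by
  have h : (0 : ℝ) < S.card := by exact_mod_cast hS
  simp only [owenTerm_diagonal]
  rw [integral_const_mul, betaCDF_measure hS, setIntegral_pow_betaMeasure h h, beta]
  have e : (S.card : ℝ) + (T \ S).card + (S.card + (S ∪ T)ᶜ.card) = S.card + d := by
    have e2 := Finset.card_sdiff_add_card T S
    rw [Finset.union_comm] at e2
    have e4 := Finset.card_add_card_compl (S ∪ T)
    rw [Fintype.card_fin] at e4
    exact_mod_cast (by omega :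
      S.card + (T \ S).card + (S.card + (S ∪ T)ᶜ.card) = S.card + d)
  rw [e, div_div, ← mul_div_assoc, Gamma_mul_Gamma_eq_faithShapWeight S T h1 h2]
  ring

/-- The termwise identity fails at `∅` and at the full coalition, where the weight is zero but the
integral is not. Exactness of the residual there removes both terms. -/
theorem sum_mul_setIntegral_owenTerm {d : ℕ} {S : Finset (Fin d)} (hS : 1 ≤ S.card)
    {r : Finset (Fin d) → ℝ} (h0 : r ∅ = 0) (h1 : r Finset.univ = 0) :
    ∑ T, r T * ∫ x in Set.Icc (0 : ℝ) 1, owenTerm S T (fun _ => x) ∂(betaCDF S.card).measure =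
      d.factorial / (d - 1) / (Real.Gamma (S.card + d) * beta S.card S.card) *
        faithShapForm d r (risingKernel S) := by
  rw [faithShapForm_apply, Finset.mul_sum]
  refine Finset.sum_congr rfl fun T _ => ?_
  rcases card_mem_Icc_or T with rfl | rfl | ⟨h2, h3⟩
  · simp [h0]
  · simp [h1]
  · rw [setIntegral_owenTerm S T hS h2 h3]
    ring

theorem SatisfiesNormalEquations.faithShapForm_risingKernel {d ℓ : ℕ} {v : Finset (Fin d) → ℝ}
    {E : LowCoalition d ℓ → ℝ} (h : SatisfiesNormalEquations v E) {S : Finset (Fin d)} (hS : S.card = ℓ)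
    (hℓ : 1 ≤ ℓ) : faithShapForm d (v - predictionMap d ℓ E) (risingKernel S) = 0 := by
  obtain ⟨F, hF⟩ := lowOrder_le_range_predictionMap d ℓ (hS ▸ risingKernel_mem_lowOrder S)
  rw [← hF]
  refine h.2.2 F ?_ ?_
  · rw [← predictionMap_apply, hF, risingKernel_empty (hS ▸ hℓ)]
  · rw [← predictionMap_apply, hF, risingKernel_univ (hS ▸ hℓ)]

theorem setIntegral_setDeriv_owenExtension {d ℓ : ℕ} (hℓ : 1 ≤ ℓ) (v : Finset (Fin d) → ℝ)
    (S : Finset (Fin d)) :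
    ∫ x in Set.Icc (0 : ℝ) 1, setDeriv S (owenExtension v) (fun _ => x) ∂(betaCDF ℓ).measure =
      ∑ T, v T * ∫ x in Set.Icc (0 : ℝ) 1, owenTerm S T (fun _ => x) ∂(betaCDF ℓ).measure := by
  simp only [setDeriv_owenExtension]
  rw [integral_finsetSum _ fun T _ =>
    (integrableOn_betaCDF hℓ (continuous_owenTerm_diagonal S T)).const_mul (v T)]
  simp only [integral_const_mul]

theorem setIntegral_setDeriv_predictionMap {d ℓ : ℕ} (hℓ : 1 ≤ ℓ) (E : LowCoalition d ℓ → ℝ)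
    {S : Finset (Fin d)} (hS : S.card = ℓ) :
    ∫ x in Set.Icc (0 : ℝ) 1, setDeriv S (owenExtension (predictionMap d ℓ E)) (fun _ => x)
      ∂(betaCDF ℓ).measure = E ⟨S, hS.le⟩ := by
  simp only [setDeriv_owenExtension, predictionMap_apply, sum_predictedValue_mul_owenTerm E hS]
  rw [setIntegral_const, betaCDF_measureReal_Icc hℓ, one_smul]

theorem SatisfiesNormalEquations.apply_eq_setIntegral {d ℓ : ℕ} (hℓ : 1 ≤ ℓ) {v : Finset (Fin d) → ℝ}
    {E : LowCoalition d ℓ → ℝ} (h : SatisfiesNormalEquations v E) {S : Finset (Fin d)} (hS : S.card = ℓ) :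
    E ⟨S, hS.le⟩ = ∫ x in Set.Icc (0 : ℝ) 1, setDeriv S (owenExtension v) (fun _ => x)
      ∂(betaCDF ℓ).measure := by
  have h0 : (v - predictionMap d ℓ E) ∅ = 0 := sub_eq_zero.2 h.1
  have h1 : (v - predictionMap d ℓ E) Finset.univ = 0 := sub_eq_zero.2 h.2.1
  have hr := sum_mul_setIntegral_owenTerm (S := S) (hS ▸ hℓ) h0 h1
  rw [h.faithShapForm_risingKernel hS hℓ, mul_zero, hS] at hr
  simp only [Pi.sub_apply, sub_mul, Finset.sum_sub_distrib] at hr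
  rw [← setIntegral_setDeriv_predictionMap hℓ E hS, setIntegral_setDeriv_owenExtension hℓ,
    setIntegral_setDeriv_owenExtension hℓ]
  exact (sub_eq_zero.1 hr).symm

theorem mainTheorem10 (d ℓ : ℕ) (hℓ : 1 ≤ ℓ) (hℓd : ℓ ≤ d) (v : Finset (Fin d) → ℝ) :
    (∃! E : LowCoalition d ℓ → ℝ, IsFaithShap ℓ v E) ∧
    ∀ E : LowCoalition d ℓ → ℝ, IsFaithShap ℓ v E →
      ∀ (S : Finset (Fin d)) (hS : S.card = ℓ),
        IntegrableOn (fun x : ℝ => setDeriv S (owenExtension v) (fun _ => x))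
          (Set.Icc 0 1) (betaCDF ℓ).measure ∧
        E ⟨S, hS.le⟩ =
          ∫ x in Set.Icc (0 : ℝ) 1,
            setDeriv S (owenExtension v) (fun _ => x) ∂(betaCDF ℓ).measure := by
  refine ⟨existsUnique_isFaithShap hℓ (hℓ.trans hℓd) v, fun E hE S hS => ⟨?_, ?_⟩⟩
  · simp only [setDeriv_owenExtension]
    exact integrableOn_betaCDF hℓ (continuous_finsetSum _ fun T _ =>
      continuous_const.mul (continuous_owenTerm_diagonal S T))
  · exact hE.satisfiesNormalEquations.apply_eq_setIntegral hℓ hS
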